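/- Quantifier-free linear integer arithmetic (QFLIA) over a set $V$ of integer variables consists of the Boolean combinations of atoms $t\le u$ and $t=u$, where $t,u$ are linear terms $c+a_1v_1+\dots+a_kv_k$ with integer constants $c,a_1,\dots,a_k$ and $v_1,\dots,v_k\in V$; formulas are interpreted over $\mathbb{Z}$. A QFLIA transition system $(V,\mathrm{Init},\mathrm{TR})$ consists of a finite set $V$ of integer variables, a QFLIA formula $\mathrm{Init}$ over $V$, and a QFLIA formula $\mathrm{TR}$ over $V\uplus V'$, where $V'=\{v' : v\in V\}$ is a copy of $V$. A state is an assignment $s\colon V\to\mathbb{Z}$, and a pair of states $(s,t)$ is a transition if $\mathrm{TR}$ holds when the unprimed variables are evaluated in $s$ and the primed variables in $t$. A safety property is a QFLIA formula $P$ over $V$. A QFLIA inductive invariant for $(V,\mathrm{Init},\mathrm{TR})$ and $P$ is a QFLIA formula $\mathrm{Inv}$ over $V$ such that (i) every state satisfying $\mathrm{Init}$ satisfies $\mathrm{Inv}$; (ii) for every transition $(s,t)$, if $s$ satisfies $\mathrm{Inv}$, then so does $t$; (iii) every state satisfying $\mathrm{Inv}$ satisfies $P$. **Theorem.** The problem of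 inferring QFLIA invariants is undecidable: no algorithm decides, given a QFLIA transition system and a QFLIA safety property, whether a QFLIA inductive invariant for them exists. -/

import Mathlib

/-! ### Syntax and semantics of quantifier-free linear integer arithmetic -/

namespace QFLIA

/-- A linear integer term over the variables `V`: the pair `(c, [(a₁, v₁), …, (aₖ, vₖ)])`
stands for `c + a₁ * v₁ + ⋯ + aₖ * vₖ`, with integer constants `c, a₁, …, aₖ`. -/
abbrev LinTerm (V : Type) : Type := ℤ × List (ℤ × V)

/-- The value of a linear term under an assignment of integers to the variables. -/
def LinTerm.eval {V : Type} (t : LinTerm V) (s : V → ℤ) : ℤ :=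
  t.1 + (t.2.map fun p => p.1 * s p.2).sum

/-- The list of variables occurring in a linear term. -/
def LinTerm.vars {V : Type} (t : LinTerm V) : List V := t.2.map Prod.snd

/-- Renaming of the variables of a linear term. -/
def LinTerm.map {V W : Type} (f : V → W) (t : LinTerm V) : LinTerm W :=
  (t.1, t.2.map fun p => (p.1, f p.2))

/-- Formulas of quantifier-free linear integer arithmetic over the variables `V`: Boolean
combinations of the atoms `t ≤ u` and `t = u`, with linear terms `t`, `u`. (The strict atom
`t < u` is `¬ (u ≤ t)`, and `φ → ψ` is `¬ φ ∨ ψ`.) -/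
inductive Formula (V : Type) : Type
  | le (t u : LinTerm V) : Formula V
  | eq (t u : LinTerm V) : Formula V
  | not (φ : Formula V) : Formula V
  | and (φ ψ : Formula V) : Formula V
  | or (φ ψ : Formula V) : Formula V

namespace Formula

/-- Satisfaction of a formula by an assignment of integers to the variables. -/
def Sat {V : Type} : Formula V → (V → ℤ) → Prop
  | le t u, s => t.eval s ≤ u.eval s
  | eq t u, s => t.eval s = u.eval s
  | not φ, s => ¬ φ.Sat s
  | and φ ψ, s => φ.Sat s ∧ ψ.Sat s
  | or φ ψ, s => φ.Sat s ∨ ψ.Sat s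

/-- The list of variables occurring in a formula. -/
def vars {V : Type} : Formula V → List V
  | le t u => t.vars ++ u.vars
  | eq t u => t.vars ++ u.vars
  | not φ => φ.vars
  | and φ ψ => φ.vars ++ ψ.vars
  | or φ ψ => φ.vars ++ ψ.vars

/-- Renaming of the variables of a formula. -/
def map {V W : Type} (f : V → W) : Formula V → Formula W
  | le t u => le (t.map f) (u.map f)
  | eq t u => eq (t.map f) (u.map f)
  | not φ => not (φ.map f)
  | and φ ψ => and (φ.map f) (ψ.map f)
  | or φ ψ => or (φ.map f) (ψ.map f)

end Formula

/-! ### Transition systems, safety properties and inductive invariants -/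

/-- A transition system expressed in QFLIA, with finitely many integer variables `v₀, …, vₙ₋₁`.
In the transition formula `Sum.inl i` is the unprimed variable `vᵢ` (value in the source state)
and `Sum.inr i` is the primed variable `vᵢ'` (value in the target state). -/
structure TransitionSystem : Type where
  numVars : ℕ
  init : Formula (Fin numVars)
  trans : Formula (Fin numVars ⊕ Fin numVars)

namespace TransitionSystem

/-- A state assigns an integer to each variable. -/
abbrev State (T : TransitionSystem) : Type := Fin T.numVars → ℤ

/-- The transitions: the pairs of states that satisfy the transition formula. -/
def Step (T : TransitionSystem) (s t : T.State) : Prop := T.trans.Sat (Sum.elim s t)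

/-- `Inv` is an inductive invariant for the system `T` and the safety property `P`. -/
structure IsInductiveInvariant (T : TransitionSystem) (P Inv : Formula (Fin T.numVars)) :
    Prop where
  initiation : ∀ s : T.State, T.init.Sat s → Inv.Sat s
  consecution : ∀ s t : T.State, Inv.Sat s → T.Step s t → Inv.Sat t
  safety : ∀ s : T.State, Inv.Sat s → P.Sat s

end TransitionSystem

/-- An instance of the problem of inferring QFLIA invariants: a transition system together with
a safety property, both expressed in QFLIA. -/
structure InferenceInstance : Type where
  sys : TransitionSystem
  prop : Formula (Fin sys.numVars)

/-- The system and the safety property have an inductive invariant expressed in QFLIA. -/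
def InferenceInstance.HasInvariant (I : InferenceInstance) : Prop :=
  ∃ Inv : Formula (Fin I.sys.numVars), I.sys.IsInductiveInvariant I.prop Inv

/-! ### Effective coding of instances by natural numbers

Computability of a predicate on instances refers to a Gödel numbering of them, set up here. -/

namespace Formula

/-- Gödel numbering of formulas. -/
def toNat {V : Type} [Encodable V] : Formula V → ℕ
  | le t u => 5 * Nat.pair (Encodable.encode t) (Encodable.encode u)
  | eq t u => 5 * Nat.pair (Encodable.encode t) (Encodable.encode u) + 1
  | not φ => 5 * φ.toNat + 2
  | and φ ψ => 5 * Nat.pair φ.toNat ψ.toNat + 3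
  | or φ ψ => 5 * Nat.pair φ.toNat ψ.toNat + 4

/-- The formula with a given number. -/
def fromNat {V : Type} [Denumerable V] (k : ℕ) : Formula V :=
  if k % 5 = 0 then
    le (Denumerable.ofNat _ (k / 5).unpair.1) (Denumerable.ofNat _ (k / 5).unpair.2)
  else if k % 5 = 1 then
    eq (Denumerable.ofNat _ (k / 5).unpair.1) (Denumerable.ofNat _ (k / 5).unpair.2)
  else if k % 5 = 2 then not (fromNat (k / 5))
  else if k % 5 = 3 then and (fromNat (k / 5).unpair.1) (fromNat (k / 5).unpair.2)
  else or (fromNat (k / 5).unpair.1) (fromNat (k / 5).unpair.2)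
termination_by k
decreasing_by
  all_goals
    have h1 := Nat.unpair_left_le (k / 5)
    have h2 := Nat.unpair_right_le (k / 5)
    omega

theorem fromNat_toNat {V : Type} [Denumerable V] (φ : Formula V) : fromNat φ.toNat = φ := by
  induction φ with
  | le t u =>
    rw [toNat, fromNat, if_pos (by omega)]
    simp only [show ∀ m, 5 * m / 5 = m by omega, Nat.unpair_pair, Denumerable.ofNat_encode]
  | eq t u =>
    rw [toNat, fromNat, if_neg (by omega), if_pos (by omega),
      show ∀ m, (5 * m + 1) / 5 = m by omega]
    simp only [Nat.unpair_pair, Denumerable.ofNat_encode]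
  | not φ ih =>
    rw [toNat, fromNat, if_neg (by omega), if_neg (by omega), if_pos (by omega),
      show ∀ m, (5 * m + 2) / 5 = m by omega, ih]
  | and φ ψ ih₁ ih₂ =>
    rw [toNat, fromNat, if_neg (by omega), if_neg (by omega), if_neg (by omega),
      if_pos (by omega), show ∀ m, (5 * m + 3) / 5 = m by omega]
    simp [ih₁, ih₂]
  | or φ ψ ih₁ ih₂ =>
    rw [toNat, fromNat, if_neg (by omega), if_neg (by omega), if_neg (by omega),
      if_neg (by omega), show ∀ m, (5 * m + 4) / 5 = m by omega]
    simp [ih₁, ih₂]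

theorem toNat_fromNat {V : Type} [Denumerable V] (k : ℕ) :
    (fromNat k : Formula V).toNat = k := by
  induction k using Nat.strong_induction_on with
  | _ k ih =>
    have h1 := Nat.unpair_left_le (k / 5)
    have h2 := Nat.unpair_right_le (k / 5)
    rw [fromNat]
    split_ifs with a b c d
    · simp only [toNat, Denumerable.encode_ofNat, Nat.pair_unpair]; omega
    · simp only [toNat, Denumerable.encode_ofNat, Nat.pair_unpair]; omega
    · rw [toNat, ih _ (by omega)]; omega
    · rw [toNat, ih _ (by omega), ih _ (by omega), Nat.pair_unpair]; omega
    · rw [toNat, ih _ (by omega), ih _ (by omega), Nat.pair_unpair]; omega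

/-- The numbering of the formulas over a countably infinite supply of variables is bijective. -/
instance instDenumerable {V : Type} [Denumerable V] : Denumerable (Formula V) :=
  Denumerable.mk' ⟨toNat, fromNat, fromNat_toNat, toNat_fromNat⟩

theorem encode_eq_toNat {V : Type} [Denumerable V] (φ : Formula V) :
    Encodable.encode φ = φ.toNat := rfl

theorem ofNat_eq_fromNat {V : Type} [Denumerable V] (k : ℕ) :
    Denumerable.ofNat (Formula V) k = fromNat k :=
  Denumerable.ofNat_of_decode rfl

theorem primrec_linTerm_vars {V : Type} [Denumerable V] :
    Primrec (LinTerm.vars : LinTerm V → List V) :=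
  Primrec.list_map Primrec.snd (Primrec.snd.comp Primrec.snd).to₂

theorem primrec_vars {V : Type} [Denumerable V] : Primrec (vars : Formula V → List V) := by
  let f : Unit → ℕ → List V := fun _ k => (fromNat k : Formula V).vars
  let at' : ℕ → List V := fun m => (Denumerable.ofNat (LinTerm V) m).vars
  let g : Unit → List (List V) → Option (List V) := fun _ L =>
    some (if L.length % 5 = 0 ∨ L.length % 5 = 1 then
        at' (L.length / 5).unpair.1 ++ at' (L.length / 5).unpair.2
      else if L.length % 5 = 2 then (L[L.length / 5]?).getD []
      else (L[(L.length / 5).unpair.1]?).getD [] ++ (L[(L.length / 5).unpair.2]?).getD [])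
  have hat : Primrec at' := primrec_linTerm_vars.comp (Primrec.ofNat _)
  have hlen : Primrec fun p : Unit × List (List V) => p.2.length :=
    Primrec.list_length.comp Primrec.snd
  have hmod : Primrec fun p : Unit × List (List V) => p.2.length % 5 :=
    Primrec.nat_mod.comp hlen (Primrec.const 5)
  have hdiv : Primrec fun p : Unit × List (List V) => p.2.length / 5 :=
    Primrec.nat_div.comp hlen (Primrec.const 5)
  have hl : Primrec fun p : Unit × List (List V) => (p.2.length / 5).unpair.1 :=
    Primrec.fst.comp (Primrec.unpair.comp hdiv)
  have hr : Primrec fun p : Unit × List (List V) => (p.2.length / 5).unpair.2 :=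
    Primrec.snd.comp (Primrec.unpair.comp hdiv)
  have hget : ∀ {i : Unit × List (List V) → ℕ}, Primrec i →
      Primrec fun p : Unit × List (List V) => (p.2[i p]?).getD [] := fun hi =>
    Primrec.option_getD.comp (Primrec.list_getElem?.comp Primrec.snd hi) (Primrec.const [])
  have hg : Primrec₂ g := by
    refine Primrec.option_some.comp (Primrec.ite ?_ ?_ (Primrec.ite ?_ ?_ ?_))
    · exact (Primrec.eq.comp hmod (Primrec.const 0)).or (Primrec.eq.comp hmod (Primrec.const 1))
    · exact Primrec.list_append.comp (hat.comp hl) (hat.comp hr)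
    · exact Primrec.eq.comp hmod (Primrec.const 2)
    · exact hget hdiv
    · exact Primrec.list_append.comp (hget hl) (hget hr)
  have hf : Primrec₂ f := by
    refine Primrec.nat_strong_rec f hg ?_
    rintro ⟨⟩ k
    have h1 := Nat.unpair_left_le (k / 5)
    have h2 := Nat.unpair_right_le (k / 5)
    have look : ∀ i, i < k →
        (((List.range k).map (f ()))[i]?).getD [] = (fromNat i : Formula V).vars := by
      intro i hi
      simp [hi, f]
    simp only [g, List.length_map, List.length_range, Option.some.injEq]
    simp only [f]
    rw [fromNat]
    by_cases a : k % 5 = 0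
    · simp [a, at', vars]
    by_cases b : k % 5 = 1
    · simp [b, at', vars]
    by_cases c : k % 5 = 2
    · rw [if_neg (by omega), if_pos c, if_neg a, if_neg b, if_pos c, look _ (by omega), vars]
    rw [if_neg (by omega), if_neg c, if_neg a, if_neg b, if_neg c, look _ (by omega),
      look _ (by omega)]
    split_ifs <;> rw [vars]
  refine (hf.comp (Primrec.const ()) Primrec.encode).of_eq fun φ => ?_
  simp only [f]
  rw [encode_eq_toNat, fromNat_toNat]

theorem vars_map {V W : Type} (f : V → W) (φ : Formula V) :
    (φ.map f).vars = φ.vars.map f := by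
  induction φ <;> simp_all [map, vars, LinTerm.map, LinTerm.vars, Function.comp_def]

theorem linTerm_map_injective {V W : Type} {f : V → W} (hf : Function.Injective f) :
    Function.Injective (LinTerm.map f) := by
  rintro ⟨c, l⟩ ⟨d, m⟩ h
  simp only [LinTerm.map, Prod.mk.injEq] at h
  obtain ⟨rfl, h⟩ := h
  refine Prod.ext rfl (List.map_injective_iff.mpr ?_ h)
  rintro ⟨a, v⟩ ⟨b, w⟩ h
  simp only [Prod.mk.injEq] at h
  exact Prod.ext h.1 (hf h.2)

theorem map_injective {V W : Type} {f : V → W} (hf : Function.Injective f) :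
    Function.Injective (map f) := by
  have ht := linTerm_map_injective hf
  intro φ
  induction φ with
  | le t u => intro ψ h; cases ψ <;> simp_all [map, ht.eq_iff]
  | eq t u => intro ψ h; cases ψ <;> simp_all [map, ht.eq_iff]
  | not φ ih =>
    intro ψ h
    cases ψ <;> simp only [map, not.injEq, reduceCtorEq] at h
    rw [ih h]
  | and φ₁ φ₂ ih₁ ih₂ =>
    intro ψ h
    cases ψ <;> simp only [map, and.injEq, reduceCtorEq] at h
    rw [ih₁ h.1, ih₂ h.2]
  | or φ₁ φ₂ ih₁ ih₂ =>
    intro ψ h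
    cases ψ <;> simp only [map, or.injEq, reduceCtorEq] at h
    rw [ih₁ h.1, ih₂ h.2]

theorem exists_linTerm_map {V W : Type} (f : V → W) (t : LinTerm W)
    (h : ∀ w ∈ t.vars, ∃ v, f v = w) : ∃ u : LinTerm V, u.map f = t := by
  obtain ⟨c, l⟩ := t
  have : ∃ m : List (ℤ × V), (m.map fun p => (p.1, f p.2)) = l := by
    induction l with
    | nil => exact ⟨[], rfl⟩
    | cons p l ih =>
      obtain ⟨m, hm⟩ := ih fun w hw => h w (List.mem_cons_of_mem _ hw)
      obtain ⟨v, hv⟩ := h p.2 (by simp [LinTerm.vars])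
      exact ⟨(p.1, v) :: m, by simp [hm, hv]⟩
  obtain ⟨m, hm⟩ := this
  exact ⟨(c, m), Prod.ext rfl hm⟩

theorem exists_map {V W : Type} (f : V → W) (φ : Formula W)
    (h : ∀ w ∈ φ.vars, ∃ v, f v = w) : ∃ ψ : Formula V, ψ.map f = φ := by
  induction φ with
  | le t u =>
    obtain ⟨a, ha⟩ := exists_linTerm_map f t fun w hw => h w (List.mem_append_left _ hw)
    obtain ⟨b, hb⟩ := exists_linTerm_map f u fun w hw => h w (List.mem_append_right _ hw)
    exact ⟨le a b, by rw [map, ha, hb]⟩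
  | eq t u =>
    obtain ⟨a, ha⟩ := exists_linTerm_map f t fun w hw => h w (List.mem_append_left _ hw)
    obtain ⟨b, hb⟩ := exists_linTerm_map f u fun w hw => h w (List.mem_append_right _ hw)
    exact ⟨eq a b, by rw [map, ha, hb]⟩
  | not φ ih =>
    obtain ⟨a, ha⟩ := ih h
    exact ⟨not a, by rw [map, ha]⟩
  | and φ ψ ih₁ ih₂ =>
    obtain ⟨a, ha⟩ := ih₁ fun w hw => h w (List.mem_append_left _ hw)
    obtain ⟨b, hb⟩ := ih₂ fun w hw => h w (List.mem_append_right _ hw)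
    exact ⟨and a b, by rw [map, ha, hb]⟩
  | or φ ψ ih₁ ih₂ =>
    obtain ⟨a, ha⟩ := ih₁ fun w hw => h w (List.mem_append_left _ hw)
    obtain ⟨b, hb⟩ := ih₂ fun w hw => h w (List.mem_append_right _ hw)
    exact ⟨or a b, by rw [map, ha, hb]⟩

end Formula

/-- Raw data `(n, Init, TR, P)`: a number of variables and three formulas whose variables are
numbered by arbitrary natural numbers. -/
abbrev RawInstance : Type := ℕ × Formula ℕ × Formula (ℕ ⊕ ℕ) × Formula ℕ

/-- Raw data are well formed if only variables with a number below `n` occur. -/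
def RawInstance.WellFormed (r : RawInstance) : Prop :=
  (∀ v ∈ r.2.1.vars, v < r.1) ∧
  (∀ v ∈ r.2.2.1.vars, Sum.elim id id v < r.1) ∧
  (∀ v ∈ r.2.2.2.vars, v < r.1)

instance RawInstance.instDecidableWellFormed : DecidablePred RawInstance.WellFormed := fun r =>
  inferInstanceAs (Decidable ((∀ v ∈ r.2.1.vars, v < r.1) ∧
    (∀ v ∈ r.2.2.1.vars, Sum.elim id id v < r.1) ∧ (∀ v ∈ r.2.2.2.vars, v < r.1)))

namespace InferenceInstance

/-- An instance, with its variables replaced by their numbers. -/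
def toRaw (I : InferenceInstance) : RawInstance :=
  (I.sys.numVars, I.sys.init.map Fin.val, I.sys.trans.map (Sum.map Fin.val Fin.val),
    I.prop.map Fin.val)

theorem toRaw_wellFormed (I : InferenceInstance) : I.toRaw.WellFormed := by
  refine ⟨?_, ?_, ?_⟩ <;> simp [toRaw, Formula.vars_map]

theorem toRaw_injective : Function.Injective toRaw := by
  rintro ⟨⟨n, i, t⟩, p⟩ ⟨⟨m, j, u⟩, q⟩ h
  simp only [toRaw, Prod.mk.injEq] at h
  obtain ⟨rfl, h1, h2, h3⟩ := h
  obtain rfl := Formula.map_injective Fin.val_injective h1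
  obtain rfl := Formula.map_injective
    (Sum.map_injective.mpr ⟨Fin.val_injective, Fin.val_injective⟩) h2
  obtain rfl := Formula.map_injective Fin.val_injective h3
  rfl

theorem exists_toRaw (r : RawInstance) (h : r.WellFormed) :
    ∃ I : InferenceInstance, I.toRaw = r := by
  obtain ⟨n, i, t, p⟩ := r
  obtain ⟨h1, h2, h3⟩ := h
  obtain ⟨i', hi⟩ := Formula.exists_map (Fin.val : Fin n → ℕ) i
    fun v hv => ⟨⟨v, h1 v hv⟩, rfl⟩
  obtain ⟨p', hp⟩ := Formula.exists_map (Fin.val : Fin n → ℕ) p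
    fun v hv => ⟨⟨v, h3 v hv⟩, rfl⟩
  obtain ⟨t', ht⟩ := Formula.exists_map
    (Sum.map (Fin.val : Fin n → ℕ) (Fin.val : Fin n → ℕ)) t fun v hv => by
      rcases v with v | v
      · exact ⟨Sum.inl ⟨v, h2 _ hv⟩, rfl⟩
      · exact ⟨Sum.inr ⟨v, h2 _ hv⟩, rfl⟩
  exact ⟨⟨⟨n, i', t'⟩, p'⟩, by simp only [toRaw, hi, ht, hp]⟩

/-- Instances correspond bijectively to well-formed raw data. -/
noncomputable def equivRaw : InferenceInstance ≃ {r : RawInstance // r.WellFormed} :=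
  Equiv.ofBijective (fun I => ⟨I.toRaw, I.toRaw_wellFormed⟩)
    ⟨fun _ _ h => toRaw_injective (congrArg Subtype.val h),
      fun r => (exists_toRaw r.1 r.2).imp fun _ h => Subtype.ext h⟩

theorem primrecPred_wellFormed : PrimrecPred RawInstance.WellFormed := by
  have hlt : PrimrecRel fun (v n : ℕ) => v < n := Primrec.nat_lt
  have hlt' : PrimrecRel fun (v : ℕ ⊕ ℕ) (n : ℕ) => Sum.elim id id v < n :=
    hlt.comp (Primrec.sumCasesOn Primrec.fst Primrec.snd.to₂ Primrec.snd.to₂ |>.of_eq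
      fun p => by rcases p with ⟨v | v, n⟩ <;> rfl) Primrec.snd
  have h1 : Primrec fun r : RawInstance => r.2.1.vars :=
    Formula.primrec_vars.comp (Primrec.fst.comp Primrec.snd)
  have h2 : Primrec fun r : RawInstance => r.2.2.1.vars :=
    Formula.primrec_vars.comp (Primrec.fst.comp (Primrec.snd.comp Primrec.snd))
  have h3 : Primrec fun r : RawInstance => r.2.2.2.vars :=
    Formula.primrec_vars.comp (Primrec.snd.comp (Primrec.snd.comp Primrec.snd))
  exact (hlt.forall_mem_list.comp h1 Primrec.fst).and
    ((hlt'.forall_mem_list.comp h2 Primrec.fst).and (hlt.forall_mem_list.comp h3 Primrec.fst))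

/-- The code of an instance is the code of its raw data. -/
noncomputable instance instPrimcodable : Primcodable InferenceInstance :=
  letI : Primcodable {r : RawInstance // r.WellFormed} :=
    Primcodable.subtype primrecPred_wellFormed
  Primcodable.ofEquiv _ equivRaw

theorem encode_eq (I : InferenceInstance) : Encodable.encode I = Encodable.encode I.toRaw := rfl

end InferenceInstance

end QFLIA

/-!
A Turing machine acts linearly on the codes of its configurations: with the two halves of the tape
written as numbers in the base given by the size of the alphabet, a move multiplies one of them by
the base and divides the other one. Its runs are thus the runs of a QFLIA transition system.

Equip this system with two counters holding the number `n` of steps made so far and its square, the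
latter updated by `(n + 1) ^ 2 = n ^ 2 + (2 * n + 1)`. At any moment the system may stop simulating
and count down instead, undoing these updates; it is an error if the second counter is not `0` when
the first one is. No error is reachable, so an invariant exists if the reachable states are
finitely many, as they are for a halting machine. If the machine runs forever, an invariant
contains the countdown state with counters `(n, n ^ 2)` for every `n`. A quantifier-free formula can
only compare `n ^ 2` with finitely many linear functions of `n`, so for large `n` it cannot tell
this state from the one with counters `(n, n ^ 2 + 1)`, from which counting down reaches an error.
Hence an invariant exists if and only if the machine halts.
-/

open Filter StateTransition Turing

namespace QFLIA

section Definable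

variable {V W : Type} {f g : (V → ℤ) → ℤ} {p q : (V → ℤ) → Prop}

/-- A function of the assignment that is the value of a linear term. -/
def IsLinear (f : (V → ℤ) → ℤ) : Prop := ∃ t : LinTerm V, ∀ s, t.eval s = f s

/-- A predicate on assignments that is expressed by a formula. -/
def Definable (p : (V → ℤ) → Prop) : Prop := ∃ φ : Formula V, ∀ s, φ.Sat s ↔ p s

theorem isLinear_const (c : ℤ) : IsLinear fun _ : V → ℤ => c :=
  ⟨(c, []), by simp [LinTerm.eval]⟩

theorem isLinear_apply (v : V) : IsLinear fun s : V → ℤ => s v :=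
  ⟨(0, [(1, v)]), by simp [LinTerm.eval]⟩

theorem IsLinear.add (hf : IsLinear f) (hg : IsLinear g) : IsLinear fun s => f s + g s := by
  obtain ⟨t, ht⟩ := hf
  obtain ⟨u, hu⟩ := hg
  refine ⟨(t.1 + u.1, t.2 ++ u.2), fun s => ?_⟩
  simp only [← ht, ← hu, LinTerm.eval, List.map_append, List.sum_append]
  ring

theorem IsLinear.const_mul (hf : IsLinear f) (c : ℤ) : IsLinear fun s => c * f s := by
  obtain ⟨t, ht⟩ := hf
  refine ⟨(c * t.1, t.2.map fun m => (c * m.1, m.2)), fun s => ?_⟩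
  simp [← ht, LinTerm.eval, mul_add, ← List.sum_map_mul_left, Function.comp_def, mul_assoc]

theorem IsLinear.sub (hf : IsLinear f) (hg : IsLinear g) : IsLinear fun s => f s - g s := by
  simpa [sub_eq_add_neg] using hf.add (hg.const_mul (-1))

theorem Definable.congr (hp : Definable p) (h : ∀ s, p s ↔ q s) : Definable q :=
  hp.imp fun _ hφ s => (hφ s).trans (h s)

theorem IsLinear.le (hf : IsLinear f) (hg : IsLinear g) : Definable fun s => f s ≤ g s := by
  obtain ⟨t, ht⟩ := hf
  obtain ⟨u, hu⟩ := hg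
  exact ⟨.le t u, fun s => by rw [Formula.Sat, ht, hu]⟩

theorem IsLinear.lt (hf : IsLinear f) (hg : IsLinear g) : Definable fun s => f s < g s :=
  ((hf.add (isLinear_const 1)).le hg).congr fun _ => Int.add_one_le_iff

theorem IsLinear.eq (hf : IsLinear f) (hg : IsLinear g) : Definable fun s => f s = g s := by
  obtain ⟨t, ht⟩ := hf
  obtain ⟨u, hu⟩ := hg
  exact ⟨.eq t u, fun s => by rw [Formula.Sat, ht, hu]⟩

theorem Definable.not (hp : Definable p) : Definable fun s => ¬ p s := by
  obtain ⟨φ, hφ⟩ := hp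
  exact ⟨.not φ, fun s => by rw [Formula.Sat, hφ]⟩

theorem Definable.and (hp : Definable p) (hq : Definable q) : Definable fun s => p s ∧ q s := by
  obtain ⟨φ, hφ⟩ := hp
  obtain ⟨ψ, hψ⟩ := hq
  exact ⟨.and φ ψ, fun s => by rw [Formula.Sat, hφ, hψ]⟩

theorem Definable.or (hp : Definable p) (hq : Definable q) : Definable fun s => p s ∨ q s := by
  obtain ⟨φ, hφ⟩ := hp
  obtain ⟨ψ, hψ⟩ := hq
  exact ⟨.or φ ψ, fun s => by rw [Formula.Sat, hφ, hψ]⟩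

theorem definable_false : Definable fun _ : V → ℤ => False :=
  ((isLinear_const 0).eq (isLinear_const 1)).congr fun _ => by simp

theorem definable_exists_mem {ι : Type*} {A : Set ι} (hA : A.Finite) {p : ι → (V → ℤ) → Prop}
    (hp : ∀ i ∈ A, Definable (p i)) : Definable fun s => ∃ i ∈ A, p i s := by
  induction A, hA using Set.Finite.induction_on with
  | empty => exact definable_false.congr fun s => by simp
  | @insert i A _ _ ih =>
    exact ((hp i (by simp)).or (ih fun j hj => hp j (by simp [hj]))).congr fun s => by simp

theorem definable_forall {ι : Type*} [Finite ι] {p : ι → (V → ℤ) → Prop}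
    (hp : ∀ i, Definable (p i)) : Definable fun s => ∀ i, p i s :=
  (definable_exists_mem Set.finite_univ fun i _ => (hp i).not).not.congr fun s => by simp

theorem definable_eq [Finite V] {σ τ : (W → ℤ) → V → ℤ} (hσ : ∀ v, IsLinear fun s => σ s v)
    (hτ : ∀ v, IsLinear fun s => τ s v) : Definable fun s => σ s = τ s :=
  (definable_forall fun v => (hσ v).eq (hτ v)).congr fun _ => funext_iff.symm

theorem definable_mem [Finite V] {A : Set (V → ℤ)} (hA : A.Finite) :
    Definable fun s => s ∈ A :=
  (definable_exists_mem hA fun a _ =>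
    definable_eq isLinear_apply fun v => isLinear_const (a v)).congr fun s => by simp

theorem IsLinear.subst (hf : IsLinear f) {σ : (W → ℤ) → V → ℤ}
    (hσ : ∀ v, IsLinear fun s => σ s v) : IsLinear fun s => f (σ s) := by
  obtain ⟨⟨c, l⟩, ht⟩ := hf
  simp only [← ht, LinTerm.eval]
  refine (isLinear_const c).add ?_
  clear ht
  induction l with
  | nil => exact isLinear_const 0
  | cons m l ih => simpa using ((hσ m.2).const_mul m.1).add ih

theorem Definable.subst (hp : Definable p) {σ : (W → ℤ) → V → ℤ}
    (hσ : ∀ v, IsLinear fun s => σ s v) : Definable fun s => p (σ s) := by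
  obtain ⟨φ, hφ⟩ := hp
  simp only [← hφ]
  clear hφ
  have eval_subst (t : LinTerm V) : IsLinear fun s => t.eval (σ s) :=
    IsLinear.subst ⟨t, fun _ => rfl⟩ hσ
  induction φ with
  | le t u => exact (eval_subst t).le (eval_subst u)
  | eq t u => exact (eval_subst t).eq (eval_subst u)
  | not φ ih => exact ih.not
  | and φ ψ ihφ ihψ => exact ihφ.and ihψ
  | or φ ψ ihφ ihψ => exact ihφ.or ihψ

end Definable

section Squares

theorem eventually_quadratic_nonpos_iff (a b c : ℤ) : ∀ᶠ n : ℕ in atTop,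
    (a * n + b * n ^ 2 + c ≤ 0 ↔ a * n + b * (n ^ 2 + 1) + c ≤ 0) := by
  filter_upwards [eventually_ge_atTop (a.natAbs + c.natAbs + 1)] with n hn
  have bound_le : |a| + |c| + 1 ≤ (n : ℤ) := by
    rw [Int.abs_eq_natAbs, Int.abs_eq_natAbs]
    exact_mod_cast hn
  obtain ⟨hc, hc'⟩ := abs_le.1 (le_refl |c|)
  obtain ⟨ha, ha'⟩ := abs_le.1 (le_refl |a|)
  have sq_dominates : |a| * n + |c| < (n : ℤ) ^ 2 := by
    nlinarith [abs_nonneg a, abs_nonneg c, bound_le]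
  rcases lt_trichotomy b 0 with hb | rfl | hb
  · have : b * (n : ℤ) ^ 2 ≤ -n ^ 2 := by nlinarith [sq_nonneg (n : ℤ)]
    exact iff_of_true (by nlinarith) (by nlinarith)
  · simp
  · have : (n : ℤ) ^ 2 ≤ b * n ^ 2 := by nlinarith [sq_nonneg (n : ℤ)]
    exact iff_of_false (by nlinarith) (by nlinarith)

theorem IsLinear.exists_eq {f : (Fin 2 → ℤ) → ℤ} (hf : IsLinear f) :
    ∃ a b c : ℤ, ∀ s, f s = a * s 0 + b * s 1 + c := by
  obtain ⟨⟨c, l⟩, ht⟩ := hf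
  simp only [← ht, LinTerm.eval]
  clear ht
  induction l with
  | nil => exact ⟨0, 0, c, by simp⟩
  | cons m l ih =>
    obtain ⟨a, b, c', h⟩ := ih
    obtain ⟨r, v⟩ := m
    simp only [List.map_cons, List.sum_cons]
    fin_cases v
    · exact ⟨a + r, b, c', fun s => by rw [Fin.zero_eta]; linear_combination h s⟩
    · exact ⟨a, b + r, c', fun s => by rw [Fin.mk_one]; linear_combination h s⟩

theorem IsLinear.eventually_le_sq_iff {f g : (Fin 2 → ℤ) → ℤ} (hf : IsLinear f)
    (hg : IsLinear g) : ∀ᶠ n : ℕ in atTop,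
      (f ![n, n ^ 2] ≤ g ![n, n ^ 2] ↔ f ![n, n ^ 2 + 1] ≤ g ![n, n ^ 2 + 1]) := by
  obtain ⟨a, b, c, h⟩ := (hf.sub hg).exists_eq
  filter_upwards [eventually_quadratic_nonpos_iff a b c] with n hn
  rw [← sub_nonpos, h, ← sub_nonpos (a := f _), h]
  exact hn

theorem Definable.eventually_sq_iff {p : (Fin 2 → ℤ) → Prop} (hp : Definable p) :
    ∀ᶠ n : ℕ in atTop, (p ![n, n ^ 2] ↔ p ![n, n ^ 2 + 1]) := by
  obtain ⟨φ, hφ⟩ := hp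
  simp only [← hφ]
  clear hφ
  have le_case (t u : LinTerm (Fin 2)) :=
    IsLinear.eventually_le_sq_iff ⟨t, fun _ => rfl⟩ ⟨u, fun _ => rfl⟩
  induction φ with
  | le t u => exact le_case t u
  | eq t u =>
    filter_upwards [le_case t u, le_case u t] with n htu hut
    simp only [Formula.Sat, le_antisymm_iff, htu, hut]
  | not φ ih => filter_upwards [ih] with n hφ using not_congr hφ
  | and φ ψ ihφ ihψ => filter_upwards [ihφ, ihψ] with n hφ hψ using and_congr hφ hψ
  | or φ ψ ihφ ihψ => filter_upwards [ihφ, ihψ] with n hφ hψ using or_congr hφ hψ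

end Squares

section Clocked

variable {k : ℕ}

/-- The state with phase `p`, counters `x` and `y`, and the values `s` for the other variables. -/
def clocked (p x y : ℤ) (s : Fin k → ℤ) : Fin (k + 3) → ℤ :=
  Fin.cons p (Fin.cons x (Fin.cons y s))

/-- The values of the variables other than the phase and the two counters. -/
def payload (u : Fin (k + 3) → ℤ) : Fin k → ℤ := fun i => u i.succ.succ.succ

theorem eq_clocked_iff {u : Fin (k + 3) → ℤ} {p x y : ℤ} {s : Fin k → ℤ} :
    u = clocked p x y s ↔ u 0 = p ∧ u 1 = x ∧ u 2 = y ∧ payload u = s := by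
  simp only [funext_iff, Fin.forall_fin_succ, clocked, payload, Fin.cons_zero, Fin.cons_succ]
  rfl

@[simp]
theorem clocked_inj {p x y p' x' y' : ℤ} {s s' : Fin k → ℤ} :
    clocked p x y s = clocked p' x' y' s' ↔ p = p' ∧ x = x' ∧ y = y' ∧ s = s' :=
  eq_clocked_iff

@[simp]
theorem clocked_zero (p x y : ℤ) (s : Fin k → ℤ) : clocked p x y s 0 = p := rfl

@[simp]
theorem clocked_one (p x y : ℤ) (s : Fin k → ℤ) : clocked p x y s 1 = x := rfl

@[simp]
theorem clocked_two (p x y : ℤ) (s : Fin k → ℤ) : clocked p x y s 2 = y := rfl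

@[simp]
theorem payload_clocked (p x y : ℤ) (s : Fin k → ℤ) : payload (clocked p x y s) = s := rfl

theorem isLinear_clocked {V : Type} {p x y : (V → ℤ) → ℤ} {s : (V → ℤ) → Fin k → ℤ}
    (hp : IsLinear p) (hx : IsLinear x) (hy : IsLinear y) (hs : ∀ i, IsLinear fun u => s u i)
    (i : Fin (k + 3)) : IsLinear fun u => clocked (p u) (x u) (y u) (s u) i := by
  refine Fin.cases hp (fun i => Fin.cases hx (fun i => Fin.cases hy hs i) i) i

/-- The clocked version of a transition relation `r`. In phase `0` it runs `r`, keeping count of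
the number of steps and of its square. At any moment it may move to phase `1`, which decrements
the first counter, keeping the second one in step as if it still were the square. -/
def ClockedStep (r : (Fin k → ℤ) → (Fin k → ℤ) → Prop) (u v : Fin (k + 3) → ℤ) : Prop :=
  (u 0 = 0 ∧ r (payload u) (payload v) ∧
      v = clocked 0 (u 1 + 1) (u 2 + (2 * u 1 + 1)) (payload v)) ∨
    (u 0 = 0 ∧ v = clocked 1 (u 1) (u 2) 0) ∨
    (u 0 = 1 ∧ 0 < u 1 ∧ v = clocked 1 (u 1 - 1) (u 2 - (2 * u 1 - 1)) 0)

/-- The error states of the clocked version of a transition relation: counting down has revealed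
that the second counter was not the square of the first. -/
def ClockedError (u : Fin (k + 3) → ℤ) : Prop := u 0 = 1 ∧ u 1 = 0 ∧ u 2 ≠ 0

theorem definable_clockedStep {r : (Fin k → ℤ) → (Fin k → ℤ) → Prop}
    (hr : Definable fun w : Fin k ⊕ Fin k → ℤ => r (w ∘ Sum.inl) (w ∘ Sum.inr)) :
    Definable fun w : Fin (k + 3) ⊕ Fin (k + 3) → ℤ =>
      ClockedStep r (w ∘ Sum.inl) (w ∘ Sum.inr) := by
  have source (i : Fin (k + 3)) : IsLinear fun w : Fin (k + 3) ⊕ Fin (k + 3) → ℤ => w (.inl i) :=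
    isLinear_apply _
  have target (i : Fin (k + 3)) : IsLinear fun w : Fin (k + 3) ⊕ Fin (k + 3) → ℤ => w (.inr i) :=
    isLinear_apply _
  have phase (p : ℤ) := (source 0).eq (isLinear_const p)
  have payload_step : Definable fun w : Fin (k + 3) ⊕ Fin (k + 3) → ℤ =>
      r (payload (w ∘ Sum.inl)) (payload (w ∘ Sum.inr)) :=
    hr.subst (σ := fun w => Sum.elim (payload (w ∘ Sum.inl)) (payload (w ∘ Sum.inr)))
      (Sum.forall.2 ⟨fun i => source i.succ.succ.succ, fun i => target i.succ.succ.succ⟩)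
  have double := (source 1).const_mul 2
  exact ((phase 0).and <| payload_step.and <| definable_eq target <|
      isLinear_clocked (isLinear_const 0) ((source 1).add (isLinear_const 1))
        ((source 2).add (double.add (isLinear_const 1))) fun i => target i.succ.succ.succ).or <|
    ((phase 0).and <| definable_eq target <|
      isLinear_clocked (isLinear_const 1) (source 1) (source 2) fun _ => isLinear_const 0).or <|
    (phase 1).and <| ((isLinear_const 0).lt (source 1)).and <| definable_eq target <|
      isLinear_clocked (isLinear_const 1) ((source 1).sub (isLinear_const 1))
        ((source 2).sub (double.sub (isLinear_const 1))) fun _ => isLinear_const 0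

theorem definable_clockedError : Definable fun u : Fin (k + 3) → ℤ => ClockedError u :=
  ((isLinear_apply 0).eq (isLinear_const 1)).and <|
    ((isLinear_apply 1).eq (isLinear_const 0)).and
      ((isLinear_apply 2).eq (isLinear_const 0)).not

section Orbit

variable {α : Type*} (f : α → Option α) (a : α)

/-- The state of the computation of `f` from `a` after `m` steps, if it has not halted before. -/
def orbit : ℕ → Option α
  | 0 => some a
  | m + 1 => (orbit m).bind f

variable {f a}

theorem reaches_of_mem_orbit {m : ℕ} {b : α} (h : b ∈ orbit f a m) : Reaches f a b := by
  induction m generalizing b with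
  | zero => obtain rfl := Option.mem_some_iff.1 h; exact .refl
  | succ m ih =>
    obtain ⟨c, hc, hb⟩ := Option.bind_eq_some_iff.1 h
    exact (ih hc).tail hb

theorem exists_mem_orbit {b : α} (h : Reaches f a b) : ∃ m, b ∈ orbit f a m := by
  induction h with
  | refl => exact ⟨0, rfl⟩
  | tail _ hb ih =>
    obtain ⟨m, hm⟩ := ih
    exact ⟨m + 1, Option.bind_eq_some_iff.2 ⟨_, hm, hb⟩⟩

theorem eval_dom_iff_exists_orbit_eq_none : (eval f a).Dom ↔ ∃ m, orbit f a m = none := by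
  classical
  simp only [Part.dom_iff_mem, mem_eval]
  constructor
  · rintro ⟨b, hab, hb⟩
    obtain ⟨m, hm⟩ := exists_mem_orbit hab
    exact ⟨m + 1, by rw [orbit, Option.mem_def.1 hm, Option.bind_some, hb]⟩
  · intro h
    obtain ⟨m, hm⟩ : ∃ m, Nat.find h = m + 1 :=
      Nat.exists_eq_succ_of_ne_zero fun h0 => by simpa [h0, orbit] using Nat.find_spec h
    obtain ⟨b, hb⟩ := Option.ne_none_iff_exists'.1 (Nat.find_min h (m := m) (by lia))
    refine ⟨b, reaches_of_mem_orbit hb, ?_⟩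
    simpa [hm, orbit, hb] using Nat.find_spec h

end Orbit

variable {α : Type*} {f : α → Option α} {a₀ : α} {e : α → Fin k → ℤ}
  {r : (Fin k → ℤ) → (Fin k → ℤ) → Prop}

/-- The relation `r` on integer vectors simulates, through the encoding `e`, the computation of
`f` from `a₀`. -/
def Simulates (r : (Fin k → ℤ) → (Fin k → ℤ) → Prop) (f : α → Option α) (a₀ : α)
    (e : α → Fin k → ℤ) : Prop :=
  ∀ a, Reaches f a₀ a → ∀ t, r (e a) t ↔ ∃ b ∈ f a, t = e b

/-- The states that the clocked simulation of `f` from `a₀` visits in fewer than `N` steps of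
`f`. -/
def clockedOrbit (f : α → Option α) (a₀ : α) (e : α → Fin k → ℤ) (N : ℕ) :
    Set (Fin (k + 3) → ℤ) :=
  {u | ∃ m : ℕ, m < N ∧
    ((∃ a ∈ orbit f a₀ m, u = clocked 0 m (m ^ 2) (e a)) ∨ u = clocked 1 m (m ^ 2) 0)}

theorem finite_clockedOrbit (N : ℕ) : (clockedOrbit f a₀ e N).Finite := by
  have : clockedOrbit f a₀ e N = ⋃ m ∈ Set.Iio N,
      (fun a => clocked 0 m (m ^ 2) (e a)) '' {a | a ∈ orbit f a₀ m} ∪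
        {clocked 1 m (m ^ 2) 0} := by
    ext u
    simp [clockedOrbit, eq_comm, or_comm]
  rw [this]
  refine (Set.finite_Iio N).biUnion fun m _ => ((Set.Subsingleton.finite ?_).image _).union
    (Set.finite_singleton _)
  exact fun a ha b hb => Option.mem_unique ha hb

theorem clockedStep_mem_clockedOrbit (hr : Simulates r f a₀ e) {N : ℕ} (hN : orbit f a₀ N = none)
    {u v : Fin (k + 3) → ℤ} (hu : u ∈ clockedOrbit f a₀ e N) (huv : ClockedStep r u v) :
    v ∈ clockedOrbit f a₀ e N := by
  obtain ⟨m, hm, ⟨a, ha, rfl⟩ | rfl⟩ := hu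
  · rcases huv with ⟨-, hstep, hv⟩ | ⟨-, rfl⟩ | ⟨h, -⟩
    · obtain ⟨b, hb, hvb⟩ := (hr a (reaches_of_mem_orbit ha) _).1 hstep
      have hmem : b ∈ orbit f a₀ (m + 1) := Option.bind_eq_some_iff.2 ⟨a, ha, hb⟩
      have hlt : m + 1 < N := (Nat.succ_le_of_lt hm).lt_of_ne (by rintro rfl; simp [hN] at hmem)
      refine ⟨m + 1, hlt, .inl ⟨b, hmem, ?_⟩⟩
      rw [hv, hvb]
      simp only [clocked_one, clocked_two, clocked_inj, true_and, and_true]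
      exact ⟨by push_cast; ring, by push_cast; ring⟩
    · exact ⟨m, hm, .inr rfl⟩
    · simp at h
  · rcases huv with ⟨h, -⟩ | ⟨h, -⟩ | ⟨-, hpos, rfl⟩
    · simp at h
    · simp at h
    · obtain ⟨n, rfl⟩ : ∃ n, m = n + 1 :=
        Nat.exists_eq_succ_of_ne_zero (by rintro rfl; simp at hpos)
      refine ⟨n, by lia, .inr ?_⟩
      simp only [clocked_one, clocked_two, clocked_inj, true_and, and_true]
      exact ⟨by push_cast; ring, by push_cast; ring⟩

theorem not_clockedError_of_mem_clockedOrbit {N : ℕ} {u : Fin (k + 3) → ℤ}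
    (hu : u ∈ clockedOrbit f a₀ e N) : ¬ ClockedError u := by
  rintro ⟨hphase, hx, hy⟩
  obtain ⟨m, -, ⟨a, -, rfl⟩ | rfl⟩ := hu
  · simp at hphase
  · simp_all

section Invariant

variable {p : (Fin (k + 3) → ℤ) → Prop}

theorem holds_orbit (hr : Simulates r f a₀ e) (hinit : p (clocked 0 0 0 (e a₀)))
    (hstep : ∀ u v, p u → ClockedStep r u v → p v) {m : ℕ} {a : α} (ha : a ∈ orbit f a₀ m) :
    p (clocked 0 m (m ^ 2) (e a)) := by
  induction m generalizing a with
  | zero => obtain rfl := Option.mem_some_iff.1 ha; simpa using hinit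
  | succ m ih =>
    obtain ⟨b, hb, hab⟩ := Option.bind_eq_some_iff.1 ha
    refine hstep _ _ (ih hb) (.inl ⟨rfl, (hr b (reaches_of_mem_orbit hb) _).2 ⟨a, hab, rfl⟩, ?_⟩)
    simp only [clocked_one, clocked_two, clocked_inj, payload_clocked, true_and, and_true]
    exact ⟨by push_cast; ring, by push_cast; ring⟩

theorem holds_countdown (hstep : ∀ u v, p u → ClockedStep r u v → p v) (c : ℤ) (m : ℕ)
    (h : p (clocked 1 m (m ^ 2 + c) 0)) : p (clocked 1 0 c 0) := by
  induction m with
  | zero => simpa using h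
  | succ m ih =>
    refine ih (hstep _ _ h (.inr (.inr ⟨rfl, by simp only [clocked_one]; positivity, ?_⟩)))
    simp only [clocked_one, clocked_two, clocked_inj, true_and, and_true]
    exact ⟨by push_cast; ring, by push_cast; ring⟩

theorem eval_dom_of_definable_invariant (hr : Simulates r f a₀ e) (hp : Definable p)
    (hinit : p (clocked 0 0 0 (e a₀))) (hstep : ∀ u v, p u → ClockedStep r u v → p v)
    (hsafe : ∀ u, p u → ¬ ClockedError u) : (eval f a₀).Dom := by
  rw [eval_dom_iff_exists_orbit_eq_none]
  by_contra! hrun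
  have holds_square (m : ℕ) : p (clocked 1 m (m ^ 2) 0) := by
    obtain ⟨a, ha⟩ := Option.ne_none_iff_exists'.1 (hrun m)
    exact hstep _ _ (holds_orbit hr hinit hstep ha) (.inr (.inl ⟨rfl, rfl⟩))
  have hcounters : Definable fun s : Fin 2 → ℤ => p (clocked 1 (s 0) (s 1) 0) :=
    hp.subst <| isLinear_clocked (isLinear_const 1) (isLinear_apply 0) (isLinear_apply 1)
      fun _ => isLinear_const 0
  obtain ⟨m, hm⟩ := hcounters.eventually_sq_iff.exists
  exact hsafe _ (holds_countdown hstep 1 m (hm.1 (holds_square m))) ⟨rfl, rfl, one_ne_zero⟩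

theorem hasInvariant_iff_eval_dom (hr : Simulates r f a₀ e) {ι π : Formula (Fin (k + 3))}
    {τ : Formula (Fin (k + 3) ⊕ Fin (k + 3))}
    (hι : ∀ u, ι.Sat u ↔ u = clocked 0 0 0 (e a₀))
    (hτ : ∀ u v, τ.Sat (Sum.elim u v) ↔ ClockedStep r u v)
    (hπ : ∀ u, π.Sat u ↔ ¬ ClockedError u) :
    InferenceInstance.HasInvariant ⟨⟨k + 3, ι, τ⟩, π⟩ ↔ (eval f a₀).Dom := by
  constructor
  · rintro ⟨Inv, hInv⟩
    exact eval_dom_of_definable_invariant hr ⟨Inv, fun _ => Iff.rfl⟩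
      (hInv.initiation _ ((hι _).2 rfl))
      (fun u v hu huv => hInv.consecution u v hu ((hτ u v).2 huv))
      fun u hu => (hπ u).1 (hInv.safety u hu)
  · intro h
    obtain ⟨N, hN⟩ := eval_dom_iff_exists_orbit_eq_none.1 h
    have hpos : 0 < N := Nat.pos_of_ne_zero (by rintro rfl; simp [orbit] at hN)
    obtain ⟨Inv, hInv⟩ := definable_mem (finite_clockedOrbit (f := f) (a₀ := a₀) (e := e) N)
    refine ⟨Inv, fun u hu => (hInv u).2 ⟨0, hpos, .inl ⟨a₀, rfl, ?_⟩⟩, fun u v hu huv => ?_,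
      fun u hu => ?_⟩
    · simpa using (hι u).1 hu
    · exact (hInv v).2 (clockedStep_mem_clockedOrbit hr hN ((hInv u).1 hu) ((hτ u v).1 huv))
    · exact (hπ u).2 (not_clockedError_of_mem_clockedOrbit ((hInv u).1 hu))

end Invariant

end Clocked

section TapeCoding

variable {Γ : Type*} [Inhabited Γ] [Finite Γ]

instance : NeZero (Nat.card Γ) := ⟨Nat.card_pos.ne'⟩

variable (Γ) in
/-- The digit in base `Nat.card Γ` that codes a tape symbol. The blank is coded by `0`, so that the
infinitely many blanks at the end of a tape do not contribute to the number coding the tape. -/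
noncomputable def digit (a : Γ) : ℕ :=
  (Finite.equivFin Γ a - Finite.equivFin Γ default : Fin (Nat.card Γ))

theorem digit_default : digit Γ default = 0 := by simp [digit]

theorem digit_lt (a : Γ) : digit Γ a < Nat.card Γ := Fin.is_lt _

theorem digit_injective : Function.Injective (digit Γ) := fun a b h => by
  simpa [digit, Fin.val_inj] using h

/-- The number with the symbols of a half-tape as its digits in base `Nat.card Γ`, the symbol
closest to the head being the least significant one. -/
noncomputable def tapeValue (L : ListBlank Γ) : ℕ :=
  L.liftOn (fun l => Nat.ofDigits (Nat.card Γ) (l.map (digit Γ))) <| by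
    rintro l _ ⟨n, rfl⟩
    simp [digit_default]

theorem tapeValue_mk (l : List Γ) :
    tapeValue (ListBlank.mk l) = Nat.ofDigits (Nat.card Γ) (l.map (digit Γ)) := rfl

theorem tapeValue_cons (a : Γ) (L : ListBlank Γ) :
    tapeValue (L.cons a) = digit Γ a + Nat.card Γ * tapeValue L := by
  induction L using ListBlank.induction_on with
  | h l =>
    rw [ListBlank.cons_mk, tapeValue_mk, tapeValue_mk, List.map_cons, Nat.ofDigits_cons]

theorem tapeValue_eq_iff (L : ListBlank Γ) (d v : ℤ) :
    (tapeValue L = d + Nat.card Γ * v ∧ 0 ≤ d ∧ d < Nat.card Γ) ↔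
      d = digit Γ L.head ∧ v = tapeValue L.tail := by
  have hval : (tapeValue L : ℤ) = digit Γ L.head + Nat.card Γ * tapeValue L.tail := by
    rw [← L.cons_head_tail, tapeValue_cons, L.cons_head_tail]
    push_cast
    rfl
  have hlt : (digit Γ L.head : ℤ) < Nat.card Γ := by exact_mod_cast digit_lt L.head
  constructor
  · rintro ⟨h, hd, hd'⟩
    have hcard : (0 : ℤ) < Nat.card Γ := hd.trans_lt hd'
    rw [hval] at h
    have quotient := congrArg (· / (Nat.card Γ : ℤ)) h
    simp only [Int.add_mul_ediv_left _ _ hcard.ne', Int.ediv_eq_zero_of_lt hd hd',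
      Int.ediv_eq_zero_of_lt (Int.natCast_nonneg _) hlt, zero_add] at quotient
    exact ⟨by rw [quotient] at h; linarith, quotient.symm⟩
  · rintro ⟨rfl, rfl⟩
    exact ⟨hval, Int.natCast_nonneg _, hlt⟩

end TapeCoding

section MachineCoding

variable {Γ Λ : Type} [Inhabited Γ]

/-- The tape obtained by executing a statement of a Post-Turing machine. -/
def applyStmt : TM0.Stmt Γ → Tape Γ → Tape Γ
  | .move d, T => T.move d
  | .write a, T => T.write a

theorem reaches_mem_support [Inhabited Λ] {M : TM0.Machine Γ Λ} {S : Set Λ} (hM : TM0.Supports M S)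
    {l : List Γ} {c : TM0.Cfg Γ Λ} (hc : Reaches (TM0.step M) (TM0.init l) c) : c.q ∈ S := by
  induction hc with
  | refl => exact hM.1
  | tail _ hstep ih => exact TM0.step_supports M hM hstep ih

variable [Finite Γ]

/-- The integer vector coding a configuration: the codes of the label and of the symbol under the
head, and the numbers coding the left and the right part of the tape. -/
noncomputable def cfgCode (label : Λ → ℕ) (c : TM0.Cfg Γ Λ) : Fin 4 → ℤ :=
  ![label c.q, digit Γ c.Tape.head, tapeValue c.Tape.left, tapeValue c.Tape.right]

/-- The effect of a statement of a Post-Turing machine on the codes of the head and of the two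
parts of the tape. A move divides the number coding one part by the base, with the new head as
remainder; both being components of `t`, this is a linear condition. -/
def StmtStep : TM0.Stmt Γ → (Fin 4 → ℤ) → (Fin 4 → ℤ) → Prop
  | .move .left, s, t => (s 2 = t 1 + Nat.card Γ * t 2 ∧ 0 ≤ t 1 ∧ t 1 < Nat.card Γ) ∧
      t 3 = s 1 + Nat.card Γ * s 3
  | .move .right, s, t => t 2 = s 1 + Nat.card Γ * s 2 ∧
      s 3 = t 1 + Nat.card Γ * t 3 ∧ 0 ≤ t 1 ∧ t 1 < Nat.card Γ
  | .write a, s, t => t 1 = digit Γ a ∧ t 2 = s 2 ∧ t 3 = s 3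

theorem definable_stmtStep (x : TM0.Stmt Γ) :
    Definable fun w : Fin 4 ⊕ Fin 4 → ℤ => StmtStep x (w ∘ Sum.inl) (w ∘ Sum.inr) := by
  have source (i : Fin 4) : IsLinear fun w : Fin 4 ⊕ Fin 4 → ℤ => w (.inl i) := isLinear_apply _
  have target (i : Fin 4) : IsLinear fun w : Fin 4 ⊕ Fin 4 → ℤ => w (.inr i) := isLinear_apply _
  have head_bounds : Definable fun w : Fin 4 ⊕ Fin 4 → ℤ =>
      0 ≤ w (.inr 1) ∧ w (.inr 1) < Nat.card Γ :=
    ((isLinear_const 0).le (target 1)).and ((target 1).lt (isLinear_const _))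
  rcases x with (_ | _) | a
  · exact (((source 2).eq ((target 1).add ((target 2).const_mul _))).and head_bounds).and
      ((target 3).eq ((source 1).add ((source 3).const_mul _)))
  · exact ((target 2).eq ((source 1).add ((source 2).const_mul _))).and
      (((source 3).eq ((target 1).add ((target 3).const_mul _))).and head_bounds)
  · exact ((target 1).eq (isLinear_const _)).and
      (((target 2).eq (source 2)).and ((target 3).eq (source 3)))

theorem stmtStep_cfgCode_iff (label : Λ → ℕ) (x : TM0.Stmt Γ) (q q' : Λ) (T : Tape Γ)
    (t : Fin 4 → ℤ) :
    t 0 = label q' ∧ StmtStep x (cfgCode label ⟨q, T⟩) t ↔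
      t = cfgCode label ⟨q', applyStmt x T⟩ := by
  have eq_code (c : TM0.Cfg Γ Λ) : t = cfgCode label c ↔ t 0 = label c.q ∧
      t 1 = digit Γ c.Tape.head ∧ t 2 = tapeValue c.Tape.left ∧ t 3 = tapeValue c.Tape.right := by
    simp [funext_iff, Fin.forall_fin_succ, cfgCode]
  rw [eq_code]
  obtain ⟨a, L, R⟩ := T
  rcases x with (_ | _) | b
  · simp [StmtStep, cfgCode, applyStmt, Tape.move, tapeValue_cons, tapeValue_eq_iff, and_assoc]
  · simp [StmtStep, cfgCode, applyStmt, Tape.move, tapeValue_cons, tapeValue_eq_iff]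
    grind
  · simp [StmtStep, cfgCode, applyStmt, Tape.write]

variable [Inhabited Λ]

/-- The transition relation on codes of configurations of a machine whose labels are restricted
to `S`. -/
def MachineStep (M : TM0.Machine Γ Λ) (S : Set Λ) (label : Λ → ℕ) (s t : Fin 4 → ℤ) : Prop :=
  ∃ q ∈ S, s 0 = label q ∧ ∃ a ∈ Set.univ, s 1 = digit Γ a ∧
    ∃ p ∈ {p | p ∈ M q a}, t 0 = label p.1 ∧ StmtStep p.2 s t

theorem definable_machineStep (M : TM0.Machine Γ Λ) {S : Set Λ} (hS : S.Finite) (label : Λ → ℕ) :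
    Definable fun w : Fin 4 ⊕ Fin 4 → ℤ =>
      MachineStep M S label (w ∘ Sum.inl) (w ∘ Sum.inr) := by
  refine definable_exists_mem hS fun q _ => ((isLinear_apply _).eq (isLinear_const _)).and <|
    definable_exists_mem Set.finite_univ fun a _ =>
      ((isLinear_apply _).eq (isLinear_const _)).and <|
        definable_exists_mem (Set.Subsingleton.finite ?_) fun p _ =>
          ((isLinear_apply _).eq (isLinear_const _)).and (definable_stmtStep _)
  exact fun _ h _ h' => Option.mem_unique h h'

theorem simulates_machineStep {M : TM0.Machine Γ Λ} {S : Set Λ} (hM : TM0.Supports M S)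
    {label : Λ → ℕ} (hlabel : S.InjOn label) (l : List Γ) :
    Simulates (MachineStep M S label) (TM0.step M) (TM0.init l) (cfgCode label) := by
  intro ⟨q, T⟩ hc t
  have hq : q ∈ S := reaches_mem_support hM hc
  have hstep : (∃ c ∈ TM0.step M ⟨q, T⟩, t = cfgCode label c) ↔
      ∃ p ∈ M q T.head, t = cfgCode label ⟨p.1, applyStmt p.2 T⟩ := by
    simp only [TM0.step, Option.mem_def, Option.map_eq_some_iff]
    constructor
    · rintro ⟨_, ⟨⟨q', _ | _⟩, hp, rfl⟩, ht⟩ <;> exact ⟨_, hp, ht⟩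
    · rintro ⟨⟨q', _ | _⟩, hp, ht⟩ <;> exact ⟨_, ⟨_, hp, rfl⟩, ht⟩
  simp only [hstep, ← stmtStep_cfgCode_iff label _ q]
  constructor
  · rintro ⟨q₁, hq₁, hcode, a, -, ha, p, hp, ht⟩
    obtain rfl := hlabel hq hq₁ (by simpa [cfgCode] using hcode)
    obtain rfl : T.head = a := digit_injective (by simpa [cfgCode] using ha)
    exact ⟨p, hp, ht⟩
  · rintro ⟨p, hp, ht⟩
    exact ⟨q, hq, rfl, T.head, trivial, rfl, p, hp, ht⟩

theorem cfgCode_init (label : Λ → ℕ) (a : Γ) (l : List Γ) :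
    cfgCode label (TM0.init (a :: l)) =
      ![(label default : ℤ), digit Γ a, 0, tapeValue (ListBlank.mk l)] := rfl

end MachineCoding

section HaltingMachine

theorem trNat_two_pow (n : ℕ) :
    PartrecToTM2.trNat (2 ^ n) = List.replicate n .bit0 ++ [.bit1] := by
  obtain ⟨p, hp, htr⟩ : ∃ p : PosNum, ((2 ^ n : ℕ) : Num) = .pos p ∧
      PartrecToTM2.trPosNum p = List.replicate n .bit0 ++ [.bit1] := by
    induction n with
    | zero => exact ⟨1, rfl, rfl⟩
    | succ n ih =>
      obtain ⟨p, hp, htr⟩ := ih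
      refine ⟨p.bit0, ?_, congrArg (_ :: ·) htr⟩
      rw [pow_succ, mul_two, Nat.cast_add, hp]
      exact Num.bit0_of_bit0 (.pos p)
  rw [PartrecToTM2.trNat, hp]
  exact htr

theorem exists_code_eval_dom_iff {f : ℕ →. ℕ} (hf : Partrec f) :
    ∃ c : ToPartrec.Code, ∀ n, (c.eval [n]).Dom ↔ (f n).Dom := by
  obtain ⟨c, hc⟩ := ToPartrec.Code.exists_code (Nat.Partrec'.part_iff₁.2 hf)
  refine ⟨c, fun n => ?_⟩
  have heval : c.eval [n] = pure <$> f n := hc (n ::ᵥ List.Vector.nil)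
  rw [heval]
  rfl

theorem exists_partrec_comp_eq {f : ℕ →. ℕ} (hf : Partrec f) {g : ℕ → ℕ} (hg : Computable g)
    (hinj : Function.Injective g) : ∃ f' : ℕ →. ℕ, Partrec f' ∧ ∀ n, f' (g n) = f n := by
  let preimage (m : ℕ) : Part ℕ := Nat.rfind fun n => Part.some (decide (g n = m))
  have partrec_preimage : Partrec preimage := Partrec.rfind <| Computable.partrec <|
    (Primrec.eq (α := ℕ)).decide.to_comp.comp (hg.comp .snd) .fst
  have preimage_apply (n : ℕ) : preimage (g n) = Part.some n :=
    Part.eq_some_iff.2 <| Nat.mem_rfind.2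
      ⟨by simp, fun hm => by simp [hinj.eq_iff, hm.ne]⟩
  exact ⟨fun m => (preimage m).bind f, partrec_preimage.bind (hf.comp .snd).to₂, fun n =>
    (congrArg (Part.bind · f) (preimage_apply n)).trans (Part.bind_some n f)⟩

open PartrecToTM2 in
instance : Finite K' :=
  Set.finite_univ_iff.1 <| (Set.toFinite {.main, .rev, .aux, .stack}).subset fun k _ => by
    cases k <;> simp

theorem eval_dom_tr_tr {K Λ σ : Type*} {Γ : K → Type*} [DecidableEq K] [Inhabited Λ]
    [Inhabited σ]
    (M : Λ → TM2.Stmt Γ Λ σ) (k : K) (L : List (Γ k)) :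
    (eval (TM0.step (TM1to0.tr (TM2to1.tr M))) (TM0.init (TM2to1.trInit k L))).Dom ↔
      (eval (TM2.step M) (TM2.init k L)).Dom := by
  change (TM0.eval (TM1to0.tr (TM2to1.tr M)) (TM2to1.trInit k L)).Dom ↔ (TM2.eval M k L).Dom
  rw [TM1to0.tr_eval, TM2to1.tr_eval_dom]

open PartrecToTM2 in
/-- The tape symbol of the one-tape simulation of Mathlib's stack machine for partial recursive
functions at a place where only the main stack, which holds the input, has a symbol. -/
def mainSymbol (bottom : Bool) (a : Γ') : TM2to1.Γ' K' fun _ => Γ' :=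
  (bottom, Function.update (fun _ => none) .main (some a))

open PartrecToTM2 in
theorem trInit_trList_two_pow (n : ℕ) :
    TM2to1.trInit (Γ := fun _ => Γ') .main (trList [2 ^ n]) =
      mainSymbol true .cons :: mainSymbol false .bit1 ::
        List.replicate n (mainSymbol false .bit0) := by
  have hreverse : (trList [2 ^ n]).reverse = .cons :: .bit1 :: List.replicate n .bit0 := by
    simp [trList, trNat_two_pow]
  rw [← List.map_replicate, TM2to1.trInit, hreverse]
  rfl

open PartrecToTM2 in
theorem exists_machine_eval_dom_iff {f : ℕ →. ℕ} (hf : Partrec f) :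
    ∃ (Γ Λ : Type) (_ : Inhabited Γ) (_ : Finite Γ) (_ : Inhabited Λ) (M : TM0.Machine Γ Λ)
      (S : Set Λ) (a b d : Γ), S.Finite ∧ TM0.Supports M S ∧
      ∀ n, (eval (TM0.step M) (TM0.init (a :: b :: List.replicate n d))).Dom ↔ (f n).Dom := by
  have computable_two_pow : Computable fun n : ℕ => 2 ^ n :=
    ((Primrec₂.unpaired'.1 Nat.Primrec.pow).comp (.const 2) .id).to_comp
  obtain ⟨f', hf', hff'⟩ :=
    exists_partrec_comp_eq hf computable_two_pow (Nat.pow_right_injective le_rfl)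
  obtain ⟨c, hc⟩ := exists_code_eval_dom_iff hf'
  let _ : Inhabited Λ' := ⟨trNormal c .halt⟩
  let _ : Fintype K' := .ofFinite K'
  refine ⟨TM2to1.Γ' K' fun _ => Γ', _, inferInstance, inferInstance, inferInstance,
    TM1to0.tr (TM2to1.tr tr), _, mainSymbol true .cons, mainSymbol false .bit1,
    mainSymbol false .bit0, Finset.finite_toSet _,
    TM1to0.tr_supports _ (TM2to1.tr_supports tr (tr_supports c .halt)), fun n => ?_⟩
  have hinit : init c [2 ^ n] = TM2.init (Γ := fun _ => Γ') .main (trList [2 ^ n]) :=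
    congrArg (TM2.Cfg.mk _ _) <| funext fun k => by cases k <;> rfl
  rw [← trInit_trList_two_pow, ← hff', ← hc]
  refine (eval_dom_tr_tr tr _ _).trans ?_
  rw [← hinit, PartrecToTM2.tr_eval]
  rfl

theorem primrec_tapeValue_replicate {Γ : Type} [Inhabited Γ] [Finite Γ] (b d : Γ) :
    Primrec fun n => tapeValue (ListBlank.mk (b :: List.replicate n d)) := by
  have hreplicate : Primrec fun n => tapeValue (ListBlank.mk (List.replicate n d)) := by
    refine (Primrec.nat_rec₁ 0 (f := fun _ v => digit Γ d + Nat.card Γ * v) ?_).of_eq fun n => ?_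
    · exact Primrec.nat_add.comp (.const _) (Primrec.nat_mul.comp (.const _) .snd)
    · induction n with
      | zero => rfl
      | succ n ih =>
        rw [List.replicate_succ, ← ListBlank.cons_mk, tapeValue_cons, ← ih]
  refine (Primrec.nat_add.comp (.const (digit Γ b))
    (Primrec.nat_mul.comp (.const (Nat.card Γ)) hreplicate)).of_eq fun n => ?_
  rw [← ListBlank.cons_mk, tapeValue_cons]

end HaltingMachine

theorem primrec_intCast : Primrec fun n : ℕ => (n : ℤ) :=
  Primrec.encode_iff.1 <| (Primrec.nat_mul.comp (.const 2) .id).of_eq fun _ => rfl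

theorem Formula.primrec_eq {α V : Type} [Primcodable α] [Denumerable V] {t u : α → LinTerm V}
    (ht : Primrec t) (hu : Primrec u) : Primrec fun a => Formula.eq (t a) (u a) :=
  Primrec.encode_iff.1 <| Primrec.nat_add.comp (Primrec.nat_mul.comp (.const 5)
    (Primrec₂.natPair.comp (Primrec.encode.comp ht) (Primrec.encode.comp hu))) (.const 1)

theorem Formula.primrec_and {α V : Type} [Primcodable α] [Denumerable V] {φ ψ : α → Formula V}
    (hφ : Primrec φ) (hψ : Primrec ψ) : Primrec fun a => Formula.and (φ a) (ψ a) :=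
  Primrec.encode_iff.1 <| Primrec.nat_add.comp (Primrec.nat_mul.comp (.const 5)
    (Primrec₂.natPair.comp (Primrec.encode.comp hφ) (Primrec.encode.comp hψ))) (.const 3)

theorem InferenceInstance.primrec_of_toRaw {α : Type} [Primcodable α] {I : α → InferenceInstance}
    (hI : Primrec fun a => (I a).toRaw) : Primrec I :=
  Primrec.encode_iff.1 <| (Primrec.encode.comp hI).of_eq fun a => ((I a).encode_eq).symm

theorem primrec_instance {k : ℕ} (v : Fin k) (ι : Formula (Fin k))
    (τ : Formula (Fin k ⊕ Fin k)) (π : Formula (Fin k)) :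
    Primrec fun n : ℕ =>
      (⟨⟨k, .and (.eq (0, [(1, v)]) (n, [])) ι, τ⟩, π⟩ : InferenceInstance) := by
  have hinit : Primrec fun n : ℕ =>
      Formula.and (.eq (0, [(1, (v : ℕ))]) (n, [])) (ι.map Fin.val) :=
    Formula.primrec_and (Formula.primrec_eq (.const _) (primrec_intCast.pair (.const [])))
      (.const _)
  exact InferenceInstance.primrec_of_toRaw <|
    (Primrec.const k).pair <| hinit.pair <|
      (Primrec.const (τ.map (Sum.map Fin.val Fin.val))).pair (.const (π.map Fin.val))

theorem exists_primrec_hasInvariant_iff {f : ℕ →. ℕ} (hf : Partrec f) :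
    ∃ I : ℕ → InferenceInstance, Primrec I ∧ ∀ n, (I n).HasInvariant ↔ (f n).Dom := by
  obtain ⟨Γ, Λ, _, _, _, M, S, a, b, d, hS, hM, hdom⟩ := exists_machine_eval_dom_iff hf
  obtain ⟨label, hlabel⟩ := Set.countable_iff_exists_injOn.1 hS.countable
  let start (v : ℤ) : Fin 7 → ℤ := clocked 0 0 0 ![label default, digit Γ a, 0, v]
  obtain ⟨ι, hι⟩ : Definable fun u : Fin 7 → ℤ => u = start (u 6) :=
    definable_eq isLinear_apply <| isLinear_clocked (isLinear_const 0) (isLinear_const 0)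
      (isLinear_const 0) fun i => by
        fin_cases i
        exacts [isLinear_const _, isLinear_const _, isLinear_const _, isLinear_apply 6]
  obtain ⟨τ, hτ⟩ := definable_clockedStep (definable_machineStep M hS label)
  obtain ⟨π, hπ⟩ := (definable_clockedError (k := 4)).not
  refine ⟨_, (primrec_instance 6 ι τ π).comp (primrec_tapeValue_replicate b d), fun n => ?_⟩
  rw [← hdom]
  refine hasInvariant_iff_eval_dom (simulates_machineStep hM hlabel _) (fun u => ?_)
    (fun u v => hτ _) hπ
  suffices u 6 = tapeValue (ListBlank.mk (b :: List.replicate n d)) ∧ u = start (u 6) ↔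
      u = start (tapeValue (ListBlank.mk (b :: List.replicate n d))) by
    simpa [Formula.Sat, LinTerm.eval, hι, cfgCode_init] using this
  constructor
  · rintro ⟨hu, h⟩
    rwa [hu] at h
  · rintro rfl
    exact ⟨rfl, rfl⟩

end QFLIA

theorem mainTheorem1 :
    ¬ ComputablePred (fun I : QFLIA.InferenceInstance => I.HasInvariant) := by
  intro h
  obtain ⟨I, hI, hhalt⟩ := QFLIA.exists_primrec_hasInvariant_iff
    (Nat.Partrec.Code.eval_part.comp (Computable.ofNat Nat.Partrec.Code) (.const 0))
  refine ComputablePred.halting_problem 0 (ComputablePred.computable_of_manyOneReducible ?_ h)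
  exact ⟨_, hI.to_comp.comp .encode, fun c => by simp [hhalt]⟩
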